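/- Proposition 3.4. Let $X$ be a real Banach space and let $(e_\gamma)_{\gamma\in\Gamma}$ be a Hamel basis of $X$. Call a map $\omega : X \to \mathbb{R}$ $z$-linear if it is homogeneous ($\omega(tx) = t\,\omega(x)$ for all $t \in \mathbb{R}$, $x \in X$) and there is a constant $C > 0$ such that $$\Big|\omega\Big(\sum_{i=1}^n x_i\Big) - \sum_{i=1}^n \omega(x_i)\Big| \le C \sum_{i=1}^n \|x_i\| \qquad \text{for all } n \text{ and all } x_1,\dots,x_n \in X;$$ let $Z(\omega)$ be the infimum of all such constants $C$. The $z$-dual $X^z$ is the Banach space of all $z$-linear maps $\omega : X \to \mathbb{R}$ with $\omega(e_\gamma) = 0$ for every $\gamma \in \Gamma$, with the norm $Z(\cdot)$. A Banach space $E$ has the bounded approximation property (BAP) if there is $\lambda$ such that for every finite dimensional subspace $F \subset E$ there is a finite rank bounded linear operator $T : E \to E$ with $\|T\| \le \lambda$ and $T(f) = f$ for all $f \in F$. If the dual space $X^*$ has the BAP, then the $z$-dual $X^z$ also has the BAP. -/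

import Mathlib

noncomputable section

/-- A (real) normed space `E` has the `lam`-bounded approximation property if for every finite
dimensional subspace `F` there is a finite rank bounded operator `T : E → E` with `‖T‖ ≤ lam`
and `T f = f` for all `f ∈ F`. -/
def HasBAPWith (lam : ℝ) (E : Type*) [NormedAddCommGroup E] [NormedSpace ℝ E] : Prop :=
  ∀ F : Submodule ℝ E, FiniteDimensional ℝ F →
    ∃ T : E →L[ℝ] E, FiniteDimensional ℝ (LinearMap.range (T : E →ₗ[ℝ] E)) ∧
      ‖T‖ ≤ lam ∧ ∀ f ∈ F, T f = f

/-- The bounded approximation property: the `lam`-BAP for some `lam`. -/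
def HasBAP (E : Type*) [NormedAddCommGroup E] [NormedSpace ℝ E] : Prop :=
  ∃ lam : ℝ, HasBAPWith lam E

section ZLinear

variable {X Y : Type*} [NormedAddCommGroup X] [NormedAddCommGroup Y]

/-- `ω` satisfies the `z`-linearity inequality with the constant `C`. -/
def ZBound (ω : X → Y) (C : ℝ) : Prop :=
  ∀ (n : ℕ) (x : Fin n → X), ‖ω (∑ i, x i) - ∑ i, ω (x i)‖ ≤ C * ∑ i, ‖x i‖

/-- `ω` is `z`-linear: homogeneous, and the `z`-linearity inequality holds with some constant. -/
structure IsZLinear [NormedSpace ℝ X] [NormedSpace ℝ Y] (ω : X → Y) : Prop where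
  homogeneous : ∀ (t : ℝ) (x : X), ω (t • x) = t • ω x
  exists_bound : ∃ C : ℝ, 0 < C ∧ ZBound ω C

/-- The `z`-linearity constant `Z(ω)`: the infimum of all admissible constants. -/
def zConst (ω : X → Y) : ℝ := sInf {C : ℝ | 0 < C ∧ ZBound ω C}

theorem zConst_nonneg (ω : X → Y) : 0 ≤ zConst ω :=
  Real.sInf_nonneg fun _ h => h.1.le

theorem zConst_le {ω : X → Y} {C : ℝ} (hC : 0 ≤ C) (h : ZBound ω C) : zConst ω ≤ C := by
  refine le_of_forall_pos_le_add fun ε hε => csInf_le ⟨0, fun _ h => h.1.le⟩ ⟨by linarith, ?_⟩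
  intro n x
  have h0 : 0 ≤ ∑ i, ‖x i‖ := Finset.sum_nonneg fun _ _ => norm_nonneg _
  exact (h n x).trans (by nlinarith)

theorem IsZLinear.zBound [NormedSpace ℝ X] [NormedSpace ℝ Y] {ω : X → Y} (h : IsZLinear ω) : ZBound ω (zConst ω) := by
  intro n x
  have h0 : 0 ≤ ∑ i, ‖x i‖ := Finset.sum_nonneg fun _ _ => norm_nonneg _
  rcases h0.eq_or_lt with h0 | h0
  · obtain ⟨C, -, hC⟩ := h.exists_bound
    simpa [← h0] using hC n x
  · rw [← div_le_iff₀ h0]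
    exact le_csInf h.exists_bound fun C hC => (div_le_iff₀ h0).2 (hC.2 n x)

theorem ZBound.add {ω η : X → Y} {C D : ℝ} (h : ZBound ω C) (k : ZBound η D) :
    ZBound (ω + η) (C + D) := by
  intro n x
  have e : (ω + η) (∑ i, x i) - ∑ i, (ω + η) (x i)
      = (ω (∑ i, x i) - ∑ i, ω (x i)) + (η (∑ i, x i) - ∑ i, η (x i)) := by
    simp only [Pi.add_apply, Finset.sum_add_distrib]; abel
  rw [e, add_mul]
  exact (norm_add_le _ _).trans (add_le_add (h n x) (k n x))

theorem ZBound.smul [NormedSpace ℝ Y] {ω : X → Y} {C : ℝ} (h : ZBound ω C) (t : ℝ) :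
    ZBound (t • ω) (|t| * C) := by
  intro n x
  have e : (t • ω) (∑ i, x i) - ∑ i, (t • ω) (x i) = t • (ω (∑ i, x i) - ∑ i, ω (x i)) := by
    simp only [Pi.smul_apply, Finset.smul_sum, smul_sub]
  rw [e, norm_smul, Real.norm_eq_abs, mul_assoc]
  exact mul_le_mul_of_nonneg_left (h n x) (abs_nonneg t)

end ZLinear

section ZDual

variable {ι X : Type*} [NormedAddCommGroup X] [NormedSpace ℝ X]

/-- The vector space of `z`-linear maps `X → ℝ` vanishing on the Hamel basis `e`. -/
def zDualSubmodule (e : Module.Basis ι ℝ X) : Submodule ℝ (X → ℝ) where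
  carrier := {ω | IsZLinear ω ∧ ∀ i, ω (e i) = 0}
  zero_mem' := ⟨⟨by simp, 1, one_pos, fun n x => by
    simpa using Finset.sum_nonneg fun i _ => norm_nonneg (x i)⟩, by simp⟩
  add_mem' := by
    rintro ω η ⟨⟨h1, C, hC, h2⟩, h3⟩ ⟨⟨k1, D, hD, k2⟩, k3⟩
    exact ⟨⟨fun t x => by simp [h1, k1, mul_add], C + D, by positivity, h2.add k2⟩,
      fun i => by simp [h3, k3]⟩
  smul_mem' := by
    rintro t ω ⟨⟨h1, C, hC, h2⟩, h3⟩
    refine ⟨⟨fun s x => by simp [h1, mul_left_comm], |t| * C + 1, by positivity, ?_⟩,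
      fun i => by simp [h3]⟩
    intro n x
    have h0 : 0 ≤ ∑ i, ‖x i‖ := Finset.sum_nonneg fun _ _ => norm_nonneg _
    exact (h2.smul t n x).trans (by nlinarith)

/-- The `z`-dual `X^z` of `X` with respect to the Hamel basis `e`: the space of `z`-linear maps
`X → ℝ` vanishing on `e`. It is a type of its own, so that its only norm and topology are those
given by the `z`-linearity constant below, not those of pointwise convergence. -/
def ZDual (e : Module.Basis ι ℝ X) : Type _ := zDualSubmodule e

namespace ZDual

variable (e : Module.Basis ι ℝ X)

instance instAddCommGroup : AddCommGroup (ZDual e) :=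
  inferInstanceAs (AddCommGroup (zDualSubmodule e))

instance instModule : Module ℝ (ZDual e) :=
  inferInstanceAs (Module ℝ (zDualSubmodule e))

/-- The norm of the `z`-dual is the `z`-linearity constant. -/
instance instNorm : Norm (ZDual e) := ⟨fun ω => zConst ω.1⟩

variable {e}

/-- Pointwise estimate: a `z`-linear functional vanishing on `e` is controlled at `x` by the
coordinates of `x`. -/
theorem abs_apply_le (ω : ZDual e) (x : X) :
    |ω.1 x| ≤ ‖ω‖ * ∑ i ∈ (e.repr x).support, ‖e.repr x i • e i‖ := by
  set s := (e.repr x).support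
  have hx : ∑ j : Fin s.card, e.repr x (s.equivFin.symm j) • e (s.equivFin.symm j) = x := by
    rw [s.equivFin.symm.sum_comp (fun i : s => e.repr x i • e i),
      Finset.sum_coe_sort s (fun i => e.repr x i • e i)]
    exact e.linearCombination_repr x
  have h := ω.2.1.zBound _ fun j : Fin s.card =>
    e.repr x (s.equivFin.symm j) • e (s.equivFin.symm j)
  rw [hx, s.equivFin.symm.sum_comp (fun i : s => ‖e.repr x i • e i‖),
      Finset.sum_coe_sort s (fun i => ‖e.repr x i • e i‖)] at h
  change |ω.1 x| ≤ zConst ω.1 * _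
  simpa [ω.2.1.homogeneous, ω.2.2] using h

theorem core : NormedSpace.Core ℝ (ZDual e) where
  norm_nonneg ω := zConst_nonneg ω.1
  norm_smul t ω := by
    have key : ∀ (t : ℝ) (ω : ZDual e), ‖t • ω‖ ≤ |t| * ‖ω‖ := fun t ω =>
      zConst_le (mul_nonneg (abs_nonneg t) (zConst_nonneg ω.1)) (ω.2.1.zBound.smul t)
    refine le_antisymm (key t ω) ?_
    rcases eq_or_ne t 0 with rfl | ht
    · rw [norm_zero, zero_mul]
      exact zConst_nonneg _
    · have h := key t⁻¹ (t • ω)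
      rw [inv_smul_smul₀ ht, abs_inv] at h
      rwa [Real.norm_eq_abs, ← le_inv_mul_iff₀ (abs_pos.2 ht)]
  norm_triangle ω η :=
    zConst_le (add_nonneg (zConst_nonneg ω.1) (zConst_nonneg η.1)) (ω.2.1.zBound.add η.2.1.zBound)
  norm_eq_zero_iff ω := by
    constructor
    · intro h
      refine Subtype.ext (funext fun x => ?_)
      have := abs_apply_le ω x
      rw [h, zero_mul] at this
      exact abs_nonpos_iff.1 this
    · rintro rfl
      refine le_antisymm (zConst_le le_rfl fun n x => ?_) (zConst_nonneg _)
      change ‖(0 : ℝ) - ∑ i : Fin n, (0 : ℝ)‖ ≤ _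
      simp

instance instNormedAddCommGroup : NormedAddCommGroup (ZDual e) :=
  NormedAddCommGroup.ofCore (core (e := e))

instance instNormedSpace : NormedSpace ℝ (ZDual e) :=
  NormedSpace.ofCore (core (e := e))

theorem norm_def (ω : ZDual e) : ‖ω‖ = zConst ω.1 := rfl

/-- The `z`-dual is complete, i.e. a Banach space. -/
instance instCompleteSpace : CompleteSpace (ZDual e) := by
  refine Metric.complete_of_cauchySeq_tendsto fun u hu => ?_
  -- pointwise limits
  have hp : ∀ x, CauchySeq fun n => (u n).1 x := by
    intro x
    set K := ∑ i ∈ (e.repr x).support, ‖e.repr x i • e i‖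
    have hK : 0 ≤ K := Finset.sum_nonneg fun _ _ => norm_nonneg _
    rw [Metric.cauchySeq_iff] at hu ⊢
    intro ε hε
    obtain ⟨N, hN⟩ := hu (ε / (K + 1)) (by positivity)
    refine ⟨N, fun m hm n hn => ?_⟩
    have h1 : |(u m).1 x - (u n).1 x| ≤ ‖u m - u n‖ * K := abs_apply_le (u m - u n) x
    have h2 := hN m hm n hn
    rw [dist_eq_norm, lt_div_iff₀ (by positivity)] at h2
    rw [Real.dist_eq]
    nlinarith [norm_nonneg (u m - u n)]
  choose v hv using fun x => cauchySeq_tendsto_of_complete (hp x)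
  have hlim : ∀ (m : ℕ) (C : ℝ) (N : ℕ), (∀ n ≥ N, ‖u n - u m‖ ≤ C) →
      ZBound (v - (u m).1) C := by
    intro m C N hC k x
    have ht : Filter.Tendsto (fun n => ‖(u n - u m).1 (∑ i, x i) - ∑ i, (u n - u m).1 (x i)‖)
        Filter.atTop (nhds ‖(v - (u m).1) (∑ i, x i) - ∑ i, (v - (u m).1) (x i)‖) :=
      (((hv _).sub_const _).sub
        (tendsto_finsetSum _ fun i _ => (hv (x i)).sub_const _)).norm
    refine le_of_tendsto ht (Filter.eventually_atTop.2 ⟨N, fun n hn => ?_⟩)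
    exact ((u n - u m).2.1.zBound k x).trans (mul_le_mul_of_nonneg_right (hC n hn)
      (Finset.sum_nonneg fun _ _ => norm_nonneg _))
  have hc : ∀ ε > 0, ∃ N, ∀ m ≥ N, ZBound (v - (u m).1) ε := by
    intro ε hε
    obtain ⟨N, hN⟩ := Metric.cauchySeq_iff.1 hu ε hε
    refine ⟨N, fun m hm => hlim m ε N fun n hn => ?_⟩
    rw [← dist_eq_norm]; exact (hN n hn m hm).le
  have hmem : v ∈ zDualSubmodule e := by
    refine ⟨⟨fun t x => ?_, ?_⟩, fun i => ?_⟩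
    · refine tendsto_nhds_unique (hv (t • x)) ?_
      simpa only [(u _).2.1.homogeneous] using (hv x).const_smul t
    · obtain ⟨N, hN⟩ := hc 1 one_pos
      refine ⟨1 + zConst (u N).1, by linarith [zConst_nonneg (u N).1], ?_⟩
      simpa using (hN N le_rfl).add (u N).2.1.zBound
    · refine tendsto_nhds_unique (hv (e i)) ?_
      simpa only [(u _).2.2] using tendsto_const_nhds
  let w : ZDual e := ⟨v, hmem⟩
  refine ⟨w, tendsto_iff_norm_sub_tendsto_zero.2 (Metric.tendsto_atTop.2 fun ε hε => ?_)⟩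
  obtain ⟨N, hN⟩ := hc (ε / 2) (by positivity)
  refine ⟨N, fun m hm => ?_⟩
  rw [Real.dist_eq, sub_zero, abs_norm, norm_sub_rev]
  refine lt_of_le_of_lt ?_ (half_lt_self hε)
  exact zConst_le (by positivity) (hN m hm)

end ZDual

end ZDual

end

/-! The `z`-dual is a quotient of `ℓ_∞` by a copy of `X*`. A bounded homogeneous function on `X`
amounts to a bounded function on the lines of `X`; subtracting the linear map with the same values
on the Hamel basis gives an element of `X^z`. Every element arises so, with control of norms,
because a `z`-linear functional lies within its constant of a linear one
(`IsZLinear.exists_linearMap_dist_le`, `exists_toZDual_eq`). The kernel consists of the bounded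
linear functionals (`toZDual_eq_zero_iff`).

The BAP passes from the kernel `Y` to the quotient (`HasBAP.of_quotient_ellInfty`). Over a finite
dimensional `F`, split `q⁻¹ F` as `Y ⊕ s F` and act by a finite rank operator `S` on `Y` and the
identity on `s F`. The section `s` may have large norm, but if `S` fixes finitely many differences
between `s` and a bounded lifting, the norm stays bounded independently of `F`
(`exists_finiteRank_on_comap`). Injectivity of `ℓ_∞` extends this operator, the BAP of `ℓ_∞`
restores finite rank, and the result descends to the quotient. -/

noncomputable section

/-! ### Injectivity and bounded approximation property of `ℓ_∞` -/

section EllInfty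

/-- The Banach space of bounded real functions on `I` with the supremum norm. -/
abbrev EllInfty (I : Type*) := lp (fun _ : I => ℝ) ⊤

variable {I : Type*} {E : Type*} [NormedAddCommGroup E] [NormedSpace ℝ E]

namespace EllInfty

/-- A uniformly bounded family of functionals is an operator into `ℓ_∞`. -/
theorem exists_clm_apply_eq (φ : I → StrongDual ℝ E) {M : ℝ} (hM : 0 ≤ M)
    (hφ : ∀ i, ‖φ i‖ ≤ M) :
    ∃ T : E →L[ℝ] EllInfty I, (∀ x i, T x i = φ i x) ∧ ‖T‖ ≤ M := by
  have hb : ∀ x i, ‖φ i x‖ ≤ M * ‖x‖ := fun x i => (φ i).le_of_opNorm_le (hφ i) x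
  let T : E →ₗ[ℝ] EllInfty I :=
    { toFun := fun x => ⟨fun i => φ i x, memℓp_infty ⟨M * ‖x‖, by rintro _ ⟨i, rfl⟩; exact hb x i⟩⟩
      map_add' := fun x y => by ext i; exact map_add (φ i) x y
      map_smul' := fun t x => by ext i; exact map_smul (φ i) t x }
  have hT : ∀ x, ‖T x‖ ≤ M * ‖x‖ := fun x =>
    lp.norm_le_of_forall_le (by positivity) (hb x)
  exact ⟨T.mkContinuous M hT, fun x i => rfl, T.mkContinuous_norm_le hM hT⟩

/-- Evaluation at a point, as a functional. -/
def eval (i : I) : StrongDual ℝ (EllInfty I) :=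
  LinearMap.mkContinuous
    { toFun := fun f => f i, map_add' := fun _ _ => rfl, map_smul' := fun _ _ => rfl } 1
    fun f => by rw [one_mul]; exact lp.norm_apply_le_norm (by simp) f i

@[simp] theorem eval_apply (i : I) (f : EllInfty I) : eval i f = f i := rfl

theorem norm_eval_le (i : I) : ‖eval i‖ ≤ 1 :=
  LinearMap.mkContinuous_norm_le _ zero_le_one _

/-- `ℓ_∞` is injective: operators into it extend from subspaces without increasing the norm. -/
theorem exists_extension (V : Submodule ℝ E) (U : V →L[ℝ] EllInfty I) :
    ∃ T : E →L[ℝ] EllInfty I, (∀ v : V, T v = U v) ∧ ‖T‖ ≤ ‖U‖ := by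
  choose φ hφ hn using fun i => exists_extension_norm_eq V ((eval i).comp U)
  obtain ⟨T, hT, hTn⟩ := exists_clm_apply_eq φ (norm_nonneg U) fun i => by
    rw [hn]
    refine (ContinuousLinearMap.opNorm_comp_le _ _).trans ?_
    exact mul_le_of_le_one_left (norm_nonneg _) (norm_eval_le i)
  exact ⟨T, fun v => lp.ext (funext fun i => by rw [hT, hφ]; rfl), hTn⟩

/-- Finite rank contractions of `ℓ_∞` approximate the identity uniformly on the unit ball of a
finite dimensional subspace. -/
theorem exists_finiteRank_approx (G : Submodule ℝ (EllInfty I)) [FiniteDimensional ℝ G] {ε : ℝ}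
    (hε : 0 < ε) :
    ∃ P : EllInfty I →L[ℝ] EllInfty I,
      FiniteDimensional ℝ (LinearMap.range (P : EllInfty I →ₗ[ℝ] EllInfty I)) ∧
      ‖P‖ ≤ 1 ∧ ∀ g ∈ G, ‖g - P g‖ ≤ ε * ‖g‖ := by
  -- The evaluations lie in a bounded subset of the finite dimensional dual of `G`, so finitely many
  -- balls of radius `ε` sort the coordinates into classes. `B` samples one coordinate per class,
  -- and `A` spreads that value over the class.
  let Φ : I → StrongDual ℝ G := fun i => (eval i).comp G.subtypeL
  have hΦ : TotallyBounded (Set.range Φ) := by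
    have hb : Bornology.IsBounded (Set.range Φ) := by
      refine (isBounded_iff_forall_norm_le (E := StrongDual ℝ G)).2 ⟨1 * ‖G.subtypeL‖, ?_⟩
      rintro _ ⟨i, rfl⟩
      exact (ContinuousLinearMap.opNorm_comp_le _ _).trans
        (mul_le_mul_of_nonneg_right (norm_eval_le i) (ContinuousLinearMap.opNorm_nonneg _))
    have : ProperSpace (StrongDual ℝ G) := FiniteDimensional.proper ℝ (StrongDual ℝ G)
    exact hb.isCompact_closure.totallyBounded.subset subset_closure
  obtain ⟨t, ht, htf, hcov⟩ :=
    Metric.finite_approx_of_totallyBounded (α := StrongDual ℝ G) hΦ ε hε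
  have : Fintype t := htf.fintype
  have hk : ∀ i, ∃ τ : t, dist (Φ i) τ < ε := fun i => by
    simpa using hcov ⟨i, rfl⟩
  choose k hk using hk
  choose r hr using fun τ : t => ht τ.2
  obtain ⟨A, hA, hAn⟩ := exists_clm_apply_eq
    (fun i => ContinuousLinearMap.proj (R := ℝ) (φ := fun _ : t => ℝ) (k i)) zero_le_one fun i =>
      ContinuousLinearMap.opNorm_le_bound _ zero_le_one fun w => by
        rw [one_mul]; exact norm_le_pi_norm w (k i)
  let B : EllInfty I →L[ℝ] (t → ℝ) := ContinuousLinearMap.pi fun τ => eval (r τ)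
  have hB : ‖B‖ ≤ 1 := ContinuousLinearMap.opNorm_le_bound _ zero_le_one fun f => by
    rw [one_mul]
    exact (pi_norm_le_iff_of_nonneg (norm_nonneg f)).2 fun τ =>
      lp.norm_apply_le_norm (by simp) f (r τ)
  refine ⟨A.comp B, ?_, ?_, fun g hg => ?_⟩
  · exact Submodule.finiteDimensional_of_le
      (S₂ := LinearMap.range (A : (t → ℝ) →ₗ[ℝ] EllInfty I)) (LinearMap.range_comp_le_range _ _)
  · refine (ContinuousLinearMap.opNorm_comp_le _ _).trans ?_
    exact mul_le_one₀ hAn (norm_nonneg _) hB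
  · refine lp.norm_le_of_forall_le (by positivity) fun i => ?_
    have h1 : (g - A.comp B g) i = (Φ i - (k i : StrongDual ℝ G)) ⟨g, hg⟩ := by
      rw [← hr]
      change g i - A (B g) i = g i - g (r (k i))
      rw [hA]; rfl
    rw [h1]
    refine (ContinuousLinearMap.le_opNorm _ _).trans ?_
    refine mul_le_mul_of_nonneg_right ?_ (norm_nonneg _)
    exact (dist_eq_norm (E := StrongDual ℝ G) _ _).symm.le.trans (hk i).le

/-- `ℓ_∞` has the bounded approximation property. -/
theorem hasBAPWith_two (I : Type*) : HasBAPWith 2 (EllInfty I) := by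
  intro G hG
  obtain ⟨π, hπ⟩ := Submodule.ClosedComplemented.of_finiteDimensional (𝕜 := ℝ) G
  let p : EllInfty I →L[ℝ] EllInfty I := G.subtypeL.comp π
  have hp : ∀ g ∈ G, p g = g := fun g hg => congrArg Subtype.val (hπ ⟨g, hg⟩)
  -- With this `ε` the correction `p - P p` has norm at most 1, however large the projection `p` is.
  obtain ⟨P, hPf, hPn, hP⟩ := exists_finiteRank_approx G (ε := (‖p‖ + 1)⁻¹) (by positivity)
  refine ⟨P + (p - P.comp p), ?_, ?_, fun g hg => ?_⟩
  · have : FiniteDimensional ℝ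
      (LinearMap.range (P : EllInfty I →ₗ[ℝ] EllInfty I) ⊔ G : Submodule ℝ (EllInfty I)) :=
      inferInstance
    refine Submodule.finiteDimensional_of_le
      (S₂ := LinearMap.range (P : EllInfty I →ₗ[ℝ] EllInfty I) ⊔ G) ?_
    rintro _ ⟨f, rfl⟩
    have : P f + (p f - P (p f)) = P (f - p f) + p f := by rw [map_sub]; abel
    change P f + (p f - P (p f)) ∈ _
    rw [this]
    exact Submodule.add_mem_sup ⟨_, rfl⟩ (π f).2
  · have h2 : ‖p - P.comp p‖ ≤ 1 := ContinuousLinearMap.opNorm_le_bound _ zero_le_one fun f => by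
      refine (hP (p f) (π f).2).trans ?_
      rw [inv_mul_le_iff₀ (by positivity)]
      nlinarith [p.le_opNorm f, norm_nonneg f]
    linarith [norm_add_le P (p - P.comp p)]
  · change P g + (p g - P (p g)) = g
    rw [hp g hg]; abel

end EllInfty

end EllInfty

end
noncomputable section

/-! ### Passing the BAP from a subspace of `ℓ_∞` to the quotient -/

section Quotient

variable {Y E Q : Type*} [NormedAddCommGroup Y] [NormedSpace ℝ Y]
  [NormedAddCommGroup E] [NormedSpace ℝ E] [NormedAddCommGroup Q] [NormedSpace ℝ Q]

/-- Let `j : Y → E` be an isometry onto the kernel of the quotient map `q : E → Q`. If `Y` has the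
BAP, then every finite dimensional `F ⊆ Q` with section `s` admits a bounded finite rank operator
on `q⁻¹ F` preserving `range j` and fixing the range of `s`. -/
theorem exists_finiteRank_on_comap {lam : ℝ} (hY : HasBAPWith lam Y) (j : Y →ₗᵢ[ℝ] E)
    (q : E →L[ℝ] Q) (hker : ∀ x, q x = 0 ↔ ∃ y, j y = x) {C : ℝ} (hC : 0 ≤ C)
    (hlift : ∀ w, ∃ x, q x = w ∧ ‖x‖ ≤ C * ‖w‖)
    (F : Submodule ℝ Q) [FiniteDimensional ℝ F] (s : F →L[ℝ] E) (hs : ∀ f, q (s f) = f) :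
    ∃ U : F.comap (q : E →ₗ[ℝ] Q) →L[ℝ] E,
      FiniteDimensional ℝ (LinearMap.range (U : F.comap (q : E →ₗ[ℝ] Q) →ₗ[ℝ] E)) ∧
      ‖U‖ ≤ (lam * (2 + C) + (C + 1)) * (‖q‖ + 1) ∧
      (∀ v : F.comap (q : E →ₗ[ℝ] Q), q v = 0 → q (U v) = 0) ∧
      ∀ (f : F) (v : F.comap (q : E →ₗ[ℝ] Q)), (v : E) = s f → U v = s f := by
  set V := F.comap (q : E →ₗ[ℝ] Q) with hV
  -- a net in the unit ball of `F`
  obtain ⟨t, ht, htf, hcov⟩ := Metric.finite_approx_of_totallyBounded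
    (isCompact_closedBall (0 : F) 1).totallyBounded (‖s‖ + 1)⁻¹ (by positivity)
  -- `g` is a bounded but possibly nonlinear lifting, `s` a linear one without a useful bound; their
  -- difference lies in the kernel.
  choose g hgq hgn using fun f : F => hlift (f : Q)
  have hy : ∀ f : F, ∃ y, j y = g f - s f := fun f =>
    (hker _).1 (by rw [map_sub, hgq, hs, sub_self])
  choose y hy using hy
  have : FiniteDimensional ℝ (Submodule.span ℝ (y '' t)) :=
    FiniteDimensional.span_of_finite ℝ (htf.image y)
  obtain ⟨S, hSf, hSn, hS⟩ := hY (Submodule.span ℝ (y '' t)) this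
  have hSy : ∀ f ∈ t, S (y f) = y f := fun f hf => hS _ (Submodule.subset_span ⟨f, hf, rfl⟩)
  have hlam : 0 ≤ lam := (norm_nonneg S).trans hSn
  -- the decomposition of `q⁻¹ F`
  let qV : V →ₗ[ℝ] F := (q : E →ₗ[ℝ] Q).restrict (p := V) (q := F) fun x hx => hx
  have hqV : ∀ v : V, (qV v : Q) = q v := fun v => rfl
  let d : V →ₗ[ℝ] E := V.subtype - (s : F →ₗ[ℝ] E) ∘ₗ qV
  have hd : ∀ v : V, d v ∈ LinearMap.range j.toLinearMap := fun v =>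
    (hker _).1 (by change q (v - s (qV v)) = 0; rw [map_sub, hs, hqV, sub_self])
  let a : V →ₗ[ℝ] Y :=
    (LinearEquiv.ofInjective j.toLinearMap j.injective).symm.toLinearMap ∘ₗ d.codRestrict _ hd
  have ha : ∀ v : V, j (a v) = v - s (qV v) := fun v =>
    congrArg Subtype.val
      ((LinearEquiv.ofInjective j.toLinearMap j.injective).apply_symm_apply ⟨d v, hd v⟩)
  let U : V →ₗ[ℝ] E :=
    j.toLinearMap ∘ₗ (S : Y →ₗ[ℝ] Y) ∘ₗ a + (s : F →ₗ[ℝ] E) ∘ₗ qV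
  have hU : ∀ v, U v = j (S (a v)) + s (qV v) := fun v => rfl
  set M := lam * (2 + C) + (C + 1) with hM
  have hM0 : 0 ≤ M := by positivity
  have key : ∀ v : V, ‖v‖ ≤ 1 → ‖q v‖ ≤ 1 → ‖U v‖ ≤ M := by
    intro v hv hqv
    obtain ⟨f, hft, hf⟩ : ∃ f ∈ t, dist (qV v) f < (‖s‖ + 1)⁻¹ := by
      simpa using hcov (show qV v ∈ Metric.closedBall (0 : F) 1 from
        mem_closedBall_zero_iff.2 hqv)
    have hf1 : ‖(f : Q)‖ ≤ 1 := by simpa using ht hft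
    have hsf : ‖s (qV v - f)‖ ≤ 1 := by
      refine (s.le_opNorm _).trans ?_
      rw [dist_eq_norm] at hf
      calc ‖s‖ * ‖qV v - f‖ ≤ (‖s‖ + 1) * (‖s‖ + 1)⁻¹ := by gcongr; linarith
        _ = 1 := mul_inv_cancel₀ (by positivity)
    have hgf : ‖g f‖ ≤ C := (hgn f).trans (mul_le_of_le_one_right hC hf1)
    have h1 : ‖a v - y f‖ ≤ 2 + C := by
      rw [← j.norm_map, map_sub, ha, hy,
        show (v : E) - s (qV v) - (g f - s f) = v - g f - s (qV v - f) by rw [map_sub]; abel]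
      have hv' : ‖(v : E)‖ ≤ 1 := hv
      linarith [norm_sub_le (v - g f) (s (qV v - f)), norm_sub_le (v : E) (g f)]
    -- Since `S` fixes `y f`, the large term `s f` combines with `j (y f)` into the bounded lift `g
    -- f`; the mesh of the net makes the remaining `s` term at most 1.
    have h2 : U v = j (S (a v - y f)) + (g f + s (qV v - f)) := by
      rw [hU, map_sub S, hSy f hft, map_sub j, hy, map_sub s]; abel
    have h3 : ‖S (a v - y f)‖ ≤ lam * (2 + C) :=
      (S.le_of_opNorm_le hSn _).trans (by gcongr)
    rw [h2]
    refine (norm_add_le _ _).trans ?_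
    rw [j.norm_map]
    linarith [norm_add_le (g f) (s (qV v - f))]
  have hbound : ∀ v : V, ‖U v‖ ≤ M * (‖q‖ + 1) * ‖v‖ := by
    intro v
    rcases eq_or_ne v 0 with rfl | hv
    · simp
    have hv0 : 0 < ‖v‖ := norm_pos_iff.2 hv
    -- Dividing by `r` brings both `v` and `q v` into their unit balls.
    set r := (‖q‖ + 1) * ‖v‖ with hr
    have hr0 : 0 < r := by positivity
    have h := key (r⁻¹ • v) ?_ ?_
    · rw [map_smul, norm_smul, norm_inv, Real.norm_of_nonneg hr0.le, inv_mul_le_iff₀ hr0] at h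
      rw [hr] at h; linarith
    · rw [norm_smul, norm_inv, Real.norm_of_nonneg hr0.le, inv_mul_le_iff₀ hr0]
      nlinarith [norm_nonneg q]
    · rw [Submodule.coe_smul, map_smul, norm_smul, norm_inv, Real.norm_of_nonneg hr0.le,
        inv_mul_le_iff₀ hr0]
      have : ‖q v‖ ≤ ‖q‖ * ‖v‖ := q.le_opNorm v
      linarith
  refine ⟨U.mkContinuous _ hbound, ?_, U.mkContinuous_norm_le (by positivity) hbound, ?_, ?_⟩
  · refine Submodule.finiteDimensional_of_le
      (S₂ := (LinearMap.range (S : Y →ₗ[ℝ] Y)).map j.toLinearMap ⊔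
        LinearMap.range (s : F →ₗ[ℝ] E)) ?_
    rintro _ ⟨v, rfl⟩
    exact Submodule.add_mem_sup ⟨_, ⟨_, rfl⟩, rfl⟩ ⟨_, rfl⟩
  · intro v hv
    have : qV v = 0 := Subtype.ext hv
    change q (U v) = 0
    rw [hU, this, map_zero, add_zero]
    exact (hker _).2 ⟨_, rfl⟩
  · intro f v hv
    have hqf : qV v = f := Subtype.ext (by rw [hqV, hv, hs])
    have h0 : a v = 0 := by
      rw [← norm_eq_zero, ← j.norm_map, ha, hqf, hv, sub_self, norm_zero]
    change U v = s f
    rw [hU, h0, hqf, map_zero, map_zero, zero_add]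

/-- An operator preserving the kernel of a quotient map descends to the quotient. -/
theorem exists_descend (q : E →L[ℝ] Q) {C : ℝ} (hC : 0 ≤ C)
    (hlift : ∀ w, ∃ x, q x = w ∧ ‖x‖ ≤ C * ‖w‖)
    (T : E →L[ℝ] E) (hT : ∀ x, q x = 0 → q (T x) = 0) :
    ∃ R : Q →L[ℝ] Q, (∀ x, R (q x) = q (T x)) ∧ ‖R‖ ≤ ‖q‖ * (‖T‖ * C) := by
  have hsurj : Function.Surjective (q : E →ₗ[ℝ] Q) := fun w =>
    let ⟨x, hx, _⟩ := hlift w; ⟨x, hx⟩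
  -- An algebraic section suffices: `R` does not depend on the lift, so its norm is estimated with
  -- the bounded lifts.
  obtain ⟨r, hr⟩ := LinearMap.exists_rightInverse_of_surjective (q : E →ₗ[ℝ] Q)
    (LinearMap.range_eq_top.2 hsurj)
  let R : Q →ₗ[ℝ] Q := (q : E →ₗ[ℝ] Q) ∘ₗ (T : E →ₗ[ℝ] E) ∘ₗ r
  have hR : ∀ x, R (q x) = q (T x) := by
    intro x
    have h : q (r (q x)) = q x := LinearMap.congr_fun hr (q x)
    have := hT (r (q x) - x) (by rw [map_sub, h, sub_self])
    rw [map_sub, map_sub, sub_eq_zero] at this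
    exact this
  have hb : ∀ w, ‖R w‖ ≤ ‖q‖ * (‖T‖ * C) * ‖w‖ := by
    intro w
    obtain ⟨x, rfl, hx⟩ := hlift w
    rw [hR]
    calc ‖q (T x)‖ ≤ ‖q‖ * (‖T‖ * ‖x‖) := q.le_opNorm_of_le (T.le_opNorm x)
      _ ≤ ‖q‖ * (‖T‖ * (C * ‖q x‖)) := by gcongr
      _ = _ := by ring
  exact ⟨R.mkContinuous _ hb, hR, R.mkContinuous_norm_le (by positivity) hb⟩

/-- The quotient of `ℓ_∞` by a subspace with the BAP has the BAP. -/
theorem HasBAP.of_quotient_ellInfty {I : Type*} (hY : HasBAP Y) (j : Y →ₗᵢ[ℝ] EllInfty I)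
    (q : EllInfty I →L[ℝ] Q) (hker : ∀ x, q x = 0 ↔ ∃ y, j y = x) {C : ℝ} (hC : 0 ≤ C)
    (hlift : ∀ w, ∃ x, q x = w ∧ ‖x‖ ≤ C * ‖w‖) : HasBAP Q := by
  obtain ⟨lam, hY⟩ := hY
  refine ⟨‖q‖ * ((2 * ((lam * (2 + C) + (C + 1)) * (‖q‖ + 1))) * C), fun F hF => ?_⟩
  choose l hl using fun w => (hlift w).imp fun _ h => h.1
  obtain ⟨r, hr⟩ := LinearMap.exists_rightInverse_of_surjective (q : EllInfty I →ₗ[ℝ] Q)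
    (LinearMap.range_eq_top.2 fun w => ⟨l w, hl w⟩)
  let s : F →L[ℝ] EllInfty I := LinearMap.toContinuousLinearMap (r ∘ₗ F.subtype)
  have hs : ∀ f, q (s f) = f := fun f => LinearMap.congr_fun hr (f : Q)
  obtain ⟨U, hUf, hUn, hU0, hUs⟩ := exists_finiteRank_on_comap hY j q hker hC hlift F s hs
  -- The extension `W` may have infinite rank; composing with `P`, which fixes the range of `U`,
  -- gives finite rank without changing the values on `q⁻¹ F`.
  obtain ⟨W, hW, hWn⟩ := EllInfty.exists_extension _ U
  obtain ⟨P, hPf, hPn, hP⟩ := EllInfty.hasBAPWith_two I _ hUf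
  have hPU : ∀ v : F.comap (q : EllInfty I →ₗ[ℝ] Q), P (W v) = U v := fun v => by rw [hW]; exact hP _ ⟨v, rfl⟩
  obtain ⟨R, hR, hRn⟩ := exists_descend q hC hlift (P.comp W) fun x hx => by
    have h := hPU ⟨x, by change q x ∈ F; rw [hx]; exact F.zero_mem⟩
    change q (P (W x)) = 0
    rw [h]
    exact hU0 _ hx
  refine ⟨R, ?_, hRn.trans ?_, fun f hf => ?_⟩
  · refine Submodule.finiteDimensional_of_le
      (S₂ := (LinearMap.range (P : EllInfty I →ₗ[ℝ] EllInfty I)).map (q : EllInfty I →ₗ[ℝ] Q)) ?_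
    rintro _ ⟨w, rfl⟩
    rw [← hl w]
    exact ⟨P (W (l w)), ⟨_, rfl⟩, (hR _).symm⟩
  · gcongr
    refine (ContinuousLinearMap.opNorm_comp_le _ _).trans ?_
    exact mul_le_mul hPn (hWn.trans hUn) (norm_nonneg _) zero_le_two
  · have hsf := hs ⟨f, hf⟩
    have h := hPU ⟨s ⟨f, hf⟩, by change q (s ⟨f, hf⟩) ∈ F; rw [hsf]; exact hf⟩
    rw [hUs ⟨f, hf⟩ _ rfl] at h
    change q (s ⟨f, hf⟩) = f at hsf
    calc R f = R (q (s ⟨f, hf⟩)) := by rw [hsf]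
      _ = q (P (W (s ⟨f, hf⟩))) := hR _
      _ = f := by rw [h, hsf]

end Quotient

end
noncomputable section

/-! ### Linear approximation of `z`-linear functionals -/

section NonlinearHahnBanach

variable {X : Type*} [NormedAddCommGroup X] [NormedSpace ℝ X]

/-- Nonlinear Hahn–Banach theorem: a real `z`-linear map is at finite distance from a linear
one. -/
theorem IsZLinear.exists_linearMap_dist_le {ω : X → ℝ} (h : IsZLinear ω) :
    ∃ L : X →ₗ[ℝ] ℝ, ∀ x, |ω x - L x| ≤ zConst ω * ‖x‖ := by
  set C := zConst ω
  -- The infimum of `D x` is the sublinear envelope of `ω + C‖·‖`; `z`-linearity bounds it below by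
  -- `ω x`, so it is finite.
  let D : X → Set ℝ := fun x =>
    {r | ∃ (n : ℕ) (y : Fin n → X), ∑ i, y i = x ∧ r = ∑ i, (ω (y i) + C * ‖y i‖)}
  have hlow : ∀ x, ∀ r ∈ D x, ω x ≤ r := by
    rintro _ _ ⟨n, y, rfl, rfl⟩
    have := le_of_abs_le (h.zBound n y)
    rw [Finset.sum_add_distrib, ← Finset.mul_sum]
    linarith
  have hmem : ∀ x, ω x + C * ‖x‖ ∈ D x := fun x => ⟨1, fun _ => x, by simp, by simp⟩
  have hbdd : ∀ x, BddBelow (D x) := fun x => ⟨ω x, hlow x⟩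
  have hsmul : ∀ c : ℝ, 0 < c → ∀ x, sInf (D (c • x)) ≤ c * sInf (D x) := by
    intro c hc x
    rw [← div_le_iff₀' hc]
    refine le_csInf ⟨_, hmem x⟩ ?_
    rintro _ ⟨n, y, rfl, rfl⟩
    rw [div_le_iff₀' hc]
    refine csInf_le (hbdd _) ⟨n, fun i => c • y i, Finset.smul_sum.symm, ?_⟩
    rw [Finset.mul_sum]
    refine Finset.sum_congr rfl fun i _ => ?_
    rw [h.homogeneous, norm_smul, Real.norm_of_nonneg hc.le, smul_eq_mul]
    ring
  obtain ⟨L, -, hL⟩ := exists_extension_of_le_sublinear (⊥ : X →ₗ.[ℝ] ℝ) (fun x => sInf (D x))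
    (fun c hc x => by
      refine le_antisymm (hsmul c hc x) ?_
      have := hsmul c⁻¹ (inv_pos.2 hc) (c • x)
      rwa [inv_smul_smul₀ hc.ne', le_inv_mul_iff₀ hc] at this)
    (fun x y => by
      rw [← sub_le_iff_le_add]
      refine le_csInf ⟨_, hmem x⟩ fun r hr => ?_
      rw [sub_le_comm]
      refine le_csInf ⟨_, hmem y⟩ fun r' hr' => ?_
      rw [sub_le_iff_le_add']
      obtain ⟨n, a, rfl, rfl⟩ := hr
      obtain ⟨m, b, rfl, rfl⟩ := hr'
      refine csInf_le (hbdd _) ⟨n + m, Fin.append a b, ?_, ?_⟩ <;> simp [Fin.sum_univ_add])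
    (fun x => by
      have hx : (x : X) = 0 := (Submodule.mem_bot ℝ).1 x.2
      have h0 : ω 0 = 0 := by simpa using h.homogeneous 0 0
      have : x = 0 := Subtype.ext hx
      subst this
      simp only [LinearPMap.map_zero]
      exact le_csInf ⟨_, hmem _⟩ fun r hr => by
        have := hlow _ r hr
        simpa [h0] using this)
  have hle : ∀ x, L x ≤ ω x + C * ‖x‖ := fun x => (hL x).trans (csInf_le (hbdd x) (hmem x))
  refine ⟨L, fun x => abs_le.2 ⟨by linarith [hle x], ?_⟩⟩
  -- Homogeneity turns the upper bound at `-x` into the missing lower bound for `L x`.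
  have h1 := hle (-x)
  have h2 : ω (-x) = -ω x := by simpa using h.homogeneous (-1) x
  rw [map_neg, h2, norm_neg] at h1
  linarith

end NonlinearHahnBanach

/-! ### Bounded homogeneous functions as `ℓ_∞` over the lines of `X` -/

section Homogenize

open scoped LinearAlgebra.Projectivization

variable {X : Type*} [NormedAddCommGroup X] [NormedSpace ℝ X]

/-- A chosen unit vector on each line. -/
def unitRep (i : ℙ ℝ X) : X := ‖i.rep‖⁻¹ • i.rep

theorem norm_unitRep (i : ℙ ℝ X) : ‖unitRep i‖ = 1 := by
  rw [unitRep, norm_smul, norm_inv, norm_norm, inv_mul_cancel₀ (norm_ne_zero_iff.2 i.rep_nonzero)]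

theorem unitRep_ne_zero (i : ℙ ℝ X) : unitRep i ≠ 0 := by
  rw [← norm_ne_zero_iff, norm_unitRep]; exact one_ne_zero

theorem mk_smul_unitRep (i : ℙ ℝ X) {c : ℝ} (h : c • unitRep i ≠ 0) :
    Projectivization.mk ℝ (c • unitRep i) h = i := by
  conv_rhs => rw [← i.mk_rep]
  rw [Projectivization.mk_eq_mk_iff']
  exact ⟨c * ‖i.rep‖⁻¹, by rw [unitRep, smul_smul]⟩

theorem exists_eq_smul_unitRep (x : X) (hx : x ≠ 0) :
    ∃ c : ℝ, x = c • unitRep (Projectivization.mk ℝ x hx) := by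
  obtain ⟨a, ha⟩ := Projectivization.exists_smul_eq_mk_rep ℝ x hx
  set i := Projectivization.mk ℝ x hx
  refine ⟨(a⁻¹ : ℝˣ) * ‖i.rep‖, ?_⟩
  rw [unitRep, smul_smul, mul_assoc, mul_inv_cancel₀ (norm_ne_zero_iff.2 i.rep_nonzero), mul_one,
    ← Units.smul_def, ← ha, inv_smul_smul]

open Classical in
/-- The homogeneous function on `X` with prescribed values at the chosen unit vectors. -/
def homogenize (f : ℙ ℝ X → ℝ) (x : X) : ℝ :=
  if hx : x = 0 then 0 else
    (exists_eq_smul_unitRep x hx).choose * f (Projectivization.mk ℝ x hx)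

theorem homogenize_smul_unitRep (f : ℙ ℝ X → ℝ) (c : ℝ) (i : ℙ ℝ X) :
    homogenize f (c • unitRep i) = c * f i := by
  rcases eq_or_ne c 0 with rfl | hc
  · simp [homogenize]
  have hx : c • unitRep i ≠ 0 := smul_ne_zero hc (unitRep_ne_zero i)
  have hs := (exists_eq_smul_unitRep _ hx).choose_spec
  rw [homogenize, dif_neg hx]
  -- The chosen scalar is forced to be `c`, because the unit vector is nonzero.
  generalize (exists_eq_smul_unitRep _ hx).choose = d at hs ⊢
  rw [mk_smul_unitRep] at hs ⊢
  rw [smul_left_injective ℝ (unitRep_ne_zero i) hs]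

theorem homogenize_zero (f : ℙ ℝ X → ℝ) : homogenize f 0 = 0 := by simp [homogenize]

/-- A homogeneous function is determined by its values at the chosen unit vectors. -/
theorem homogenize_comp_unitRep {ω : X → ℝ} (h : ∀ (t : ℝ) (x : X), ω (t • x) = t * ω x) (x : X) :
    homogenize (fun i => ω (unitRep i)) x = ω x := by
  rcases eq_or_ne x 0 with rfl | hx
  · rw [homogenize_zero]; simpa using (h 0 0).symm
  obtain ⟨c, hc⟩ := exists_eq_smul_unitRep x hx
  rw [hc, homogenize_smul_unitRep, h]

theorem homogenize_smul (f : ℙ ℝ X → ℝ) (t : ℝ) (x : X) :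
    homogenize f (t • x) = t * homogenize f x := by
  rcases eq_or_ne x 0 with rfl | hx
  · simp [homogenize_zero]
  obtain ⟨c, hc⟩ := exists_eq_smul_unitRep x hx
  rw [hc, smul_smul, homogenize_smul_unitRep, homogenize_smul_unitRep, mul_assoc]

theorem abs_homogenize_le (f : EllInfty (ℙ ℝ X)) (x : X) : |homogenize f x| ≤ ‖f‖ * ‖x‖ := by
  rcases eq_or_ne x 0 with rfl | hx
  · simp [homogenize_zero]
  obtain ⟨c, hc⟩ := exists_eq_smul_unitRep x hx
  have := lp.norm_apply_le_norm (by simp) f (Projectivization.mk ℝ x hx)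
  rw [Real.norm_eq_abs] at this
  generalize Projectivization.mk ℝ x hx = i at *
  rw [hc, homogenize_smul_unitRep, norm_smul, norm_unitRep, abs_mul, Real.norm_eq_abs, mul_one,
    mul_comm]
  gcongr

theorem homogenize_add (f g : ℙ ℝ X → ℝ) (x : X) :
    homogenize (f + g) x = homogenize f x + homogenize g x := by
  unfold homogenize
  split_ifs
  · simp
  · simp [mul_add]

theorem homogenize_const_smul (t : ℝ) (f : ℙ ℝ X → ℝ) (x : X) :
    homogenize (t • f) x = t * homogenize f x := by
  unfold homogenize
  split_ifs
  · simp
  · simp [mul_left_comm]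

theorem homogenize_unitRep (f : ℙ ℝ X → ℝ) (i : ℙ ℝ X) : homogenize f (unitRep i) = f i := by
  simpa using homogenize_smul_unitRep f 1 i

variable (X) in
/-- Restriction to the chosen unit vectors embeds `X*` isometrically into `ℓ_∞`. -/
theorem exists_isometry_dual_ellInfty :
    ∃ j : StrongDual ℝ X →ₗᵢ[ℝ] EllInfty (ℙ ℝ X), ∀ φ i, j φ i = φ (unitRep i) := by
  obtain ⟨T, hT, hTn⟩ := EllInfty.exists_clm_apply_eq
    (fun i : ℙ ℝ X => ContinuousLinearMap.apply ℝ ℝ (unitRep i)) zero_le_one fun i =>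
      ContinuousLinearMap.opNorm_le_bound _ zero_le_one fun φ => by
        rw [one_mul]
        simpa [norm_unitRep] using φ.le_opNorm (unitRep i)
  refine ⟨⟨T, fun φ => le_antisymm (by simpa using T.le_of_opNorm_le hTn φ) ?_⟩, hT⟩
  refine φ.opNorm_le_bound (norm_nonneg _) fun x => ?_
  -- The homogeneous extension of `T φ` is `φ` itself, so this gives `‖φ‖ ≤ ‖T φ‖`.
  have h := abs_homogenize_le (T φ) x
  rwa [show (T φ : ℙ ℝ X → ℝ) = fun i => φ (unitRep i) from funext (hT φ),
    homogenize_comp_unitRep (fun t x => by simp)] at h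

/-! ### The `z`-dual as a quotient of `ℓ_∞` by `X*` -/

variable {ι : Type*} (e : Module.Basis ι ℝ X)

/-- The linear map agreeing with the homogeneous function of `f` on the Hamel basis. -/
def basisInterp (f : ℙ ℝ X → ℝ) : X →ₗ[ℝ] ℝ := e.constr ℝ fun k => homogenize f (e k)

theorem basisInterp_basis (f : ℙ ℝ X → ℝ) (k : ι) : basisInterp e f (e k) = homogenize f (e k) :=
  e.constr_basis ℝ _ k

theorem basisInterp_eq {f : ℙ ℝ X → ℝ} {L : X →ₗ[ℝ] ℝ} (h : ∀ k, homogenize f (e k) = L (e k)) :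
    basisInterp e f = L :=
  e.ext fun k => by rw [basisInterp_basis, h]

/-- The linear part cancels in the defect. The factor 2 counts the value at the sum and the sum of
the values. -/
theorem zBound_homogenize_sub (f : EllInfty (ℙ ℝ X)) :
    ZBound (fun x => homogenize f x - basisInterp e f x) (2 * ‖f‖) := by
  intro n x
  have h1 := abs_homogenize_le f (∑ i, x i)
  have h2 : |∑ i, homogenize f (x i)| ≤ ∑ i, ‖f‖ * ‖x i‖ :=
    (Finset.abs_sum_le_sum_abs _ _).trans (Finset.sum_le_sum fun i _ => abs_homogenize_le f (x i))
  have h3 : ‖f‖ * ‖∑ i, x i‖ ≤ ‖f‖ * ∑ i, ‖x i‖ := by gcongr; exact norm_sum_le _ _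
  rw [← Finset.mul_sum] at h2
  beta_reduce
  rw [map_sum, Finset.sum_sub_distrib, sub_sub_sub_cancel_right, Real.norm_eq_abs]
  linarith [abs_sub (homogenize f (∑ i, x i)) (∑ i, homogenize f (x i))]

/-- The quotient map of `ℓ_∞` onto the `z`-dual: a bounded homogeneous function is corrected by a
linear one so as to vanish on the Hamel basis. -/
def toZDualₗ : EllInfty (ℙ ℝ X) →ₗ[ℝ] ZDual e where
  toFun f := ⟨fun x => homogenize f x - basisInterp e f x,
    ⟨fun t x => by simp [homogenize_smul, mul_sub], 2 * ‖f‖ + 1, by positivity, fun n x =>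
      (zBound_homogenize_sub e f n x).trans (by gcongr; linarith)⟩,
    fun k => by simp [basisInterp_basis]⟩
  map_add' f g := Subtype.ext <| funext fun x => by
    have : basisInterp e (f + g : EllInfty (ℙ ℝ X)) = basisInterp e f + basisInterp e g :=
      basisInterp_eq e fun k => by
        rw [LinearMap.add_apply, basisInterp_basis, basisInterp_basis]; exact homogenize_add _ _ _
    change homogenize (f + g : EllInfty (ℙ ℝ X)) x - basisInterp e (f + g : EllInfty (ℙ ℝ X)) x
      = (homogenize f x - basisInterp e f x) + (homogenize g x - basisInterp e g x)
    rw [this, lp.coeFn_add, homogenize_add, LinearMap.add_apply]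
    ring
  map_smul' t f := Subtype.ext <| funext fun x => by
    have : basisInterp e (t • f : EllInfty (ℙ ℝ X)) = t • basisInterp e f :=
      basisInterp_eq e fun k => by
        rw [LinearMap.smul_apply, basisInterp_basis]; exact homogenize_const_smul _ _ _
    change homogenize (t • f : EllInfty (ℙ ℝ X)) x - basisInterp e (t • f : EllInfty (ℙ ℝ X)) x
      = t * (homogenize f x - basisInterp e f x)
    rw [this, lp.coeFn_smul, homogenize_const_smul, LinearMap.smul_apply, smul_eq_mul]
    ring

/-- `toZDualₗ` as a bounded operator. -/
def toZDual : EllInfty (ℙ ℝ X) →L[ℝ] ZDual e :=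
  (toZDualₗ e).mkContinuous 2 fun f => zConst_le (by positivity) (zBound_homogenize_sub e f)

theorem toZDual_apply (f : EllInfty (ℙ ℝ X)) (x : X) :
    (toZDual e f).1 x = homogenize f x - basisInterp e f x := rfl

/-- Vanishing makes the homogeneous extension linear, and its bound `‖f‖ * ‖x‖` makes it continuous.
-/
theorem toZDual_eq_zero_iff {j : StrongDual ℝ X →ₗᵢ[ℝ] EllInfty (ℙ ℝ X)}
    (hj : ∀ φ i, j φ i = φ (unitRep i)) (f : EllInfty (ℙ ℝ X)) :
    toZDual e f = 0 ↔ ∃ φ, j φ = f := by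
  constructor
  · intro h
    have hf : ∀ x, homogenize f x = basisInterp e f x := fun x => by
      rw [← sub_eq_zero, ← toZDual_apply, h]; rfl
    refine ⟨(basisInterp e f).mkContinuous ‖f‖ fun x => ?_, ?_⟩
    · rw [← hf]; exact abs_homogenize_le f x
    · refine lp.ext (funext fun i => ?_)
      rw [hj]
      change basisInterp e f (unitRep i) = _
      rw [← hf, homogenize_unitRep]
  · rintro ⟨φ, rfl⟩
    have hφ : ∀ x, homogenize (j φ) x = φ x := by
      rw [show (j φ : ℙ ℝ X → ℝ) = fun i => φ (unitRep i) from funext (hj φ)]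
      exact homogenize_comp_unitRep fun t x => by simp
    refine Subtype.ext (funext fun x => ?_)
    change (toZDual e (j φ)).1 x = 0
    rw [toZDual_apply, hφ, basisInterp_eq e (L := (φ : X →ₗ[ℝ] ℝ)) fun k => hφ (e k)]
    exact sub_self _

/-- The lift is `ω - L` on unit vectors, with `L` from the nonlinear Hahn–Banach theorem. As `ω`
vanishes on the basis, the linear correction is `-L`, which gives back `ω`. -/
theorem exists_toZDual_eq (ω : ZDual e) : ∃ f, toZDual e f = ω ∧ ‖f‖ ≤ 1 * ‖ω‖ := by
  obtain ⟨L, hL⟩ := ω.2.1.exists_linearMap_dist_le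
  have hb : ∀ i : ℙ ℝ X, ‖ω.1 (unitRep i) - L (unitRep i)‖ ≤ ‖ω‖ := fun i => by
    have := hL (unitRep i)
    rwa [norm_unitRep, mul_one] at this
  let f : EllInfty (ℙ ℝ X) := ⟨fun i => ω.1 (unitRep i) - L (unitRep i),
    memℓp_infty ⟨‖ω‖, by rintro _ ⟨i, rfl⟩; exact hb i⟩⟩
  have hf : ∀ x, homogenize f x = ω.1 x - L x :=
    homogenize_comp_unitRep (ω := fun x => ω.1 x - L x) fun t x => by
      rw [ω.2.1.homogeneous, map_smul, smul_eq_mul, smul_eq_mul, mul_sub]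
  refine ⟨f, Subtype.ext (funext fun x => ?_), ?_⟩
  · rw [toZDual_apply, hf, basisInterp_eq e (L := -L) fun k => by rw [hf, ω.2.2]; simp]
    simp
  · rw [one_mul]; exact lp.norm_le_of_forall_le (norm_nonneg _) hb

end Homogenize

end

theorem proposition3p4 {X : Type*} [NormedAddCommGroup X] [NormedSpace ℝ X] [CompleteSpace X]
    {ι : Type*} (e : Module.Basis ι ℝ X) (h : HasBAP (StrongDual ℝ X)) :
    HasBAP (ZDual e) := by
  obtain ⟨j, hj⟩ := exists_isometry_dual_ellInfty X
  exact h.of_quotient_ellInfty j (toZDual e) (toZDual_eq_zero_iff e hj) zero_le_one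
    (exists_toZDual_eq e)
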